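/- Let $\mathbb F$ be a field and let $q\in\mathbb F$ be nonzero with $q^4\neq 1$. Let $\Delta_q$ (the universal Askey--Wilson algebra) be the associative unital $\mathbb F$-algebra defined by generators $A,B,C$ and the relations asserting that each of $$A+\frac{qBC-q^{-1}CB}{q^2-q^{-2}},\qquad B+\frac{qCA-q^{-1}AC}{q^2-q^{-2}},\qquad C+\frac{qAB-q^{-1}BA}{q^2-q^{-2}}$$ is central in $\Delta_q$. Let $\alpha,\beta,\gamma$ denote $q+q^{-1}$ times the first, second and third of these elements, respectively, and let $$\Omega=q^{-1}ACB+q^{-2}A^2+q^{-2}B^2+q^2C^2-q^{-1}A\alpha-q^{-1}B\beta-qC\gamma .$$ Then the elements $$A^iC^jB^k\Omega^\ell\alpha^r\beta^s\gamma^t,\qquad j\in\{0,1\},\quad i,k,\ell,r,s,t\in\mathbb N=\{0,1,2,\ldots\},$$ form a basis of the $\mathbb F$-vector space $\Delta_q$. -/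

import Mathlib

/-- The three generators of the universal Askey-Wilson algebra. -/
inductive AWGen : Type
  | A
  | B
  | C

namespace UAW

variable {F : Type*} [Field F] {R : Type*} [Ring R] [Algebra F R]

/-- The expression `X + (q Y Z - q⁻¹ Z Y) / (q² - q⁻²)` in an `F`-algebra. -/
def centralExpr (q : F) (X Y Z : R) : R :=
  X + (q ^ 2 - q⁻¹ ^ 2)⁻¹ • (q • (Y * Z) - q⁻¹ • (Z * Y))

/-- The defining relations, on the free algebra on `A, B, C`: each of
`A + (qBC - q⁻¹CB)/(q² - q⁻²)`, `B + (qCA - q⁻¹AC)/(q² - q⁻²)`,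
`C + (qAB - q⁻¹BA)/(q² - q⁻²)` commutes with everything. -/
inductive Rel (q : F) : FreeAlgebra F AWGen → FreeAlgebra F AWGen → Prop
  | centralA (x : FreeAlgebra F AWGen) :
      Rel q
        (centralExpr q (FreeAlgebra.ι F AWGen.A) (FreeAlgebra.ι F AWGen.B)
          (FreeAlgebra.ι F AWGen.C) * x)
        (x * centralExpr q (FreeAlgebra.ι F AWGen.A) (FreeAlgebra.ι F AWGen.B)
          (FreeAlgebra.ι F AWGen.C))
  | centralB (x : FreeAlgebra F AWGen) :
      Rel q
        (centralExpr q (FreeAlgebra.ι F AWGen.B) (FreeAlgebra.ι F AWGen.C)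
          (FreeAlgebra.ι F AWGen.A) * x)
        (x * centralExpr q (FreeAlgebra.ι F AWGen.B) (FreeAlgebra.ι F AWGen.C)
          (FreeAlgebra.ι F AWGen.A))
  | centralC (x : FreeAlgebra F AWGen) :
      Rel q
        (centralExpr q (FreeAlgebra.ι F AWGen.C) (FreeAlgebra.ι F AWGen.A)
          (FreeAlgebra.ι F AWGen.B) * x)
        (x * centralExpr q (FreeAlgebra.ι F AWGen.C) (FreeAlgebra.ι F AWGen.A)
          (FreeAlgebra.ι F AWGen.B))

end UAW

/-- The universal Askey-Wilson algebra `Δ_q` over the field `F`. -/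
abbrev UniversalAskeyWilson {F : Type*} [Field F] (q : F) : Type _ :=
  RingQuot (UAW.Rel q)

namespace UniversalAskeyWilson

variable {F : Type*} [Field F] (q : F)

/-- The image in `Δ_q` of a generator. -/
noncomputable def gen (g : AWGen) : UniversalAskeyWilson q :=
  RingQuot.mkAlgHom F (UAW.Rel q) (FreeAlgebra.ι F g)

/-- The generator `A` of `Δ_q`. -/
noncomputable def A : UniversalAskeyWilson q := gen q AWGen.A

/-- The generator `B` of `Δ_q`. -/
noncomputable def B : UniversalAskeyWilson q := gen q AWGen.B

/-- The generator `C` of `Δ_q`. -/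
noncomputable def C : UniversalAskeyWilson q := gen q AWGen.C

/-- `α = (q + q⁻¹) (A + (qBC - q⁻¹CB)/(q² - q⁻²))`. -/
noncomputable def α : UniversalAskeyWilson q :=
  (q + q⁻¹) • UAW.centralExpr q (A q) (B q) (C q)

/-- `β = (q + q⁻¹) (B + (qCA - q⁻¹AC)/(q² - q⁻²))`. -/
noncomputable def β : UniversalAskeyWilson q :=
  (q + q⁻¹) • UAW.centralExpr q (B q) (C q) (A q)

/-- `γ = (q + q⁻¹) (C + (qAB - q⁻¹BA)/(q² - q⁻²))`. -/
noncomputable def γ : UniversalAskeyWilson q :=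
  (q + q⁻¹) • UAW.centralExpr q (C q) (A q) (B q)

/-- The Casimir element
`Ω = q⁻¹ACB + q⁻²A² + q⁻²B² + q²C² - q⁻¹Aα - q⁻¹Bβ - qCγ`. -/
noncomputable def Ω : UniversalAskeyWilson q :=
  q⁻¹ • (A q * C q * B q) + q⁻¹ ^ 2 • A q ^ 2 + q⁻¹ ^ 2 • B q ^ 2 + q ^ 2 • C q ^ 2
    - q⁻¹ • (A q * α q) - q⁻¹ • (B q * β q) - q • (C q * γ q)

end UniversalAskeyWilson

/-! Work over K = F[Ω, α, β, γ], which maps into the center of Δ_q: the claim becomes that Δ_q is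
K-free on the A^i C^j B^k with j ≤ 1. The relations reorder words as A, C, B, and the Casimir
equation solved for C² caps j at 1. In place of a confluence argument, left multiplication by A, B,
C is written down on the free K-module with these symbols. The operators satisfy the relations
(`relations_op`) and Ω acts as its variable (`casimir_op`), so Δ_q acts K-linearly. Acting on the
symbol 1 = A^0 C^0 B^0 then inverts the map sending symbols to monomials
(`exists_linearEquiv_model`), giving spanning and independence at once. -/

namespace UAW

/-! ### Relations with scalar parameters and the Casimir element -/

/-- Scalars for a presentation of an Askey–Wilson algebra over `R`: `q`, its inverse `p`, the values
`a`, `b`, `g` of the three central expressions and the value `w` of the Casimir element. -/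
structure Params (R : Type*) [CommRing R] where
  q : R
  p : R
  a : R
  b : R
  g : R
  w : R
  qp : q * p = 1

namespace Params

variable {R : Type*} [CommRing R] (P : Params R)

/-- The scalar `q² - q⁻²`. -/
abbrev δ : R := P.q ^ 2 - P.p ^ 2

/-- The relation between `X` and `Y` saying that `Z + (q X Y - q⁻¹ Y X) / (q² - q⁻²)` is the
scalar `c`, solved for `Y X`. -/
structure Relations {D : Type*} [Ring D] [Algebra R D] (A B C : D) : Prop where
  mul_BA : B * A = P.q ^ 2 • (A * B) - (P.q * P.δ) • (P.g • 1 - C)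
  mul_CA : C * A = P.p ^ 2 • (A * C) + (P.p * P.δ) • (P.b • 1 - B)
  mul_BC : B * C = P.p ^ 2 • (C * B) + (P.p * P.δ) • (P.a • 1 - A)

/-- The Casimir element. -/
def casimir {D : Type*} [Ring D] [Algebra R D] (A B C : D) : D :=
  P.p • (A * C * B) + P.p ^ 2 • A ^ 2 + P.p ^ 2 • B ^ 2 + P.q ^ 2 • C ^ 2
    - (P.p * (P.q + P.p) * P.a) • A - (P.p * (P.q + P.p) * P.b) • B
    - (P.q * (P.q + P.p) * P.g) • C

section

variable {D : Type*} [Ring D] [Algebra R D] {A B C : D}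

/-- The third relation is not assumed: moving A left past B and C uses only the other two. This
reduces that relation on the model to the vectors with i = 0. -/
theorem commute_bracket
    (hB : B * A = P.q ^ 2 • (A * B) - (P.q * P.δ) • (P.g • 1 - C))
    (hC : C * A = P.p ^ 2 • (A * C) + (P.p * P.δ) • (P.b • 1 - B)) :
    Commute A (B * C - P.p ^ 2 • (C * B) - (P.p * P.δ) • (P.a • 1 - A)) := by
  have hB' (x : D) : B * (A * x) =
      P.q ^ 2 • (A * (B * x)) - (P.q * P.δ) • (P.g • x - C * x) := by
    rw [← mul_assoc, hB]; simp [sub_mul, mul_assoc]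
  have hC' (x : D) : C * (A * x) =
      P.p ^ 2 • (A * (C * x)) + (P.p * P.δ) • (P.b • x - B * x) := by
    rw [← mul_assoc, hC]; simp [sub_mul, add_mul, mul_assoc]
  have := P.qp
  simp only [Commute, SemiconjBy, mul_sub, sub_mul, mul_assoc, hB, hC, hB', hC', mul_add,
    mul_smul_comm, smul_mul_assoc, mul_one, one_mul]
  match_scalars <;> grind

/-- Rewriting both products into the order A, C, B gives the same normal form. -/
theorem Relations.commute_casimir (h : P.Relations A B C) :
    Commute A (P.casimir A B C) ∧ Commute B (P.casimir A B C) ∧ Commute C (P.casimir A B C) := by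
  obtain ⟨hB, hC, hBC⟩ := h
  have hB' (x : D) : B * (A * x) =
      P.q ^ 2 • (A * (B * x)) - (P.q * P.δ) • (P.g • x - C * x) := by
    rw [← mul_assoc, hB]; simp [sub_mul, mul_assoc]
  have hC' (x : D) : C * (A * x) =
      P.p ^ 2 • (A * (C * x)) + (P.p * P.δ) • (P.b • x - B * x) := by
    rw [← mul_assoc, hC]; simp [sub_mul, add_mul, mul_assoc]
  have hBC' (x : D) : B * (C * x) =
      P.p ^ 2 • (C * (B * x)) + (P.p * P.δ) • (P.a • x - A * x) := by
    rw [← mul_assoc, hBC]; simp [sub_mul, add_mul, mul_assoc]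
  have := P.qp
  refine ⟨?_, ?_, ?_⟩ <;>
  · simp only [Commute, SemiconjBy, casimir, pow_two A, pow_two B, pow_two C, mul_sub, sub_mul,
      mul_assoc, hB, hC, hBC, hB', hC', hBC', mul_add, add_mul,
      mul_smul_comm, smul_mul_assoc, mul_one]
    match_scalars <;> grind

end

/-! ### The model and its operators -/

/-- The free module on symbols `A^i C^j B^k`. -/
abbrev Model (R : Type*) [CommRing R] : Type _ := (ℕ × Fin 2 × ℕ) →₀ R

/-- The basis vector `A^i C^j B^k`. -/
noncomputable abbrev e (R : Type*) [CommRing R] (i : ℕ) (j : Fin 2) (k : ℕ) : Model R :=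
  Finsupp.single (i, j, k) 1

/-- The linear map of the model with prescribed values on basis vectors. -/
noncomputable def ofBasis {M : Type*} [AddCommGroup M] [Module R M] (f : ℕ → Fin 2 → ℕ → M) :
    Model R →ₗ[R] M :=
  Finsupp.linearCombination R fun x => f x.1 x.2.1 x.2.2

@[simp] theorem ofBasis_e {M : Type*} [AddCommGroup M] [Module R M] (f : ℕ → Fin 2 → ℕ → M)
    (i : ℕ) (j : Fin 2) (k : ℕ) : ofBasis f (e R i j k) = f i j k := by
  simp [ofBasis]

theorem hom_ext {M : Type*} [AddCommGroup M] [Module R M] {f g : Model R →ₗ[R] M}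
    (h : ∀ i j k, f (e R i j k) = g (e R i j k)) : f = g := by
  refine Finsupp.lhom_ext' fun ⟨i, j, k⟩ => LinearMap.ext_ring ?_
  simpa using h i j k

/-- Left multiplication by `A` on the model. -/
noncomputable def opA : Module.End R (Model R) := ofBasis fun i j k => e R (i + 1) j k

/-- The vectors `B A^i C^j B^k` and `C A^i C^j B^k` of the model. -/
noncomputable def leftBC : ℕ → Fin 2 → ℕ → Model R × Model R
  | 0, 0, k => (e R 0 0 (k + 1), e R 0 1 k)
  | 0, 1, k =>
    (P.p ^ 2 • e R 0 1 (k + 1) + (P.p * P.δ) • (P.a • e R 0 0 k - e R 1 0 k),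
      -- This is C² B^k, with C² eliminated by setting the Casimir element equal to w.
      P.p ^ 2 • (P.w • e R 0 0 k - P.p • e R 1 1 (k + 1) - P.p ^ 2 • e R 2 0 k
        - P.p ^ 2 • e R 0 0 (k + 2) + (P.p * (P.q + P.p) * P.a) • e R 1 0 k
        + (P.p * (P.q + P.p) * P.b) • e R 0 0 (k + 1) + (P.q * (P.q + P.p) * P.g) • e R 0 1 k))
  -- B and C are defined together, since moving either past A produces the other.
  | i + 1, j, k =>
    (P.q ^ 2 • opA (leftBC i j k).1 - (P.q * P.δ) • (P.g • e R i j k - (leftBC i j k).2),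
      P.p ^ 2 • opA (leftBC i j k).2 + (P.p * P.δ) • (P.b • e R i j k - (leftBC i j k).1))

/-- Left multiplication by `B` on the model. -/
noncomputable def opB : Module.End R (Model R) := ofBasis fun i j k => (P.leftBC i j k).1

/-- Left multiplication by `C` on the model. -/
noncomputable def opC : Module.End R (Model R) := ofBasis fun i j k => (P.leftBC i j k).2

@[simp] theorem opA_e (i : ℕ) (j : Fin 2) (k : ℕ) : opA (e R i j k) = e R (i + 1) j k := by
  simp [opA]

theorem opB_opA (v : Model R) :
    P.opB (opA v) = P.q ^ 2 • opA (P.opB v) - (P.q * P.δ) • (P.g • v - P.opC v) := by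
  have : P.opB * opA = P.q ^ 2 • (opA * P.opB) - (P.q * P.δ) • (P.g • 1 - P.opC) :=
    hom_ext fun i j k => by simp [opB, opC, leftBC]
  simpa using congr($this v)

theorem opC_opA (v : Model R) :
    P.opC (opA v) = P.p ^ 2 • opA (P.opC v) + (P.p * P.δ) • (P.b • v - P.opB v) := by
  have : P.opC * opA = P.p ^ 2 • (opA * P.opC) + (P.p * P.δ) • (P.b • 1 - P.opB) :=
    hom_ext fun i j k => by simp [opB, opC, leftBC]
  simpa using congr($this v)

theorem opB_e_zero (k : ℕ) : P.opB (e R 0 0 k) = e R 0 0 (k + 1) := by simp [opB, leftBC]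

theorem opC_e_zero (k : ℕ) : P.opC (e R 0 0 k) = e R 0 1 k := by simp [opC, leftBC]

theorem opB_e_one (k : ℕ) : P.opB (e R 0 1 k) =
    P.p ^ 2 • e R 0 1 (k + 1) + (P.p * P.δ) • (P.a • e R 0 0 k - opA (e R 0 0 k)) := by
  simp [opB, leftBC]

theorem opC_e_one (k : ℕ) : P.opC (e R 0 1 k) =
    P.p ^ 2 • (P.w • e R 0 0 k - P.p • opA (e R 0 1 (k + 1)) - P.p ^ 2 • opA (opA (e R 0 0 k))
        - P.p ^ 2 • e R 0 0 (k + 2) + (P.p * (P.q + P.p) * P.a) • opA (e R 0 0 k)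
        + (P.p * (P.q + P.p) * P.b) • e R 0 0 (k + 1)
        + (P.q * (P.q + P.p) * P.g) • e R 0 1 k) := by
  simp [opC, leftBC]

/-- The relations with A on the right hold by the recursion. For the third, the defect commutes with
A, so it need only vanish at i = 0. -/
theorem relations_op : P.Relations opA P.opB P.opC := by
  have hB : P.opB * opA = P.q ^ 2 • (opA * P.opB) - (P.q * P.δ) • (P.g • 1 - P.opC) :=
    LinearMap.ext fun v => by simpa using P.opB_opA v
  have hC : P.opC * opA = P.p ^ 2 • (opA * P.opC) + (P.p * P.δ) • (P.b • 1 - P.opB) :=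
    LinearMap.ext fun v => by simpa using P.opC_opA v
  refine ⟨hB, hC, ?_⟩
  have hT := P.commute_bracket (D := Module.End R (Model R)) (A := opA) hB hC
  suffices P.opB * P.opC - P.p ^ 2 • (P.opC * P.opB) - (P.p * P.δ) • (P.a • 1 - opA) = 0 from
    (sub_eq_iff_eq_add' (G := Module.End R (Model R))).1 (sub_eq_zero.1 this)
  refine hom_ext fun i j k => ?_
  induction i with
  | zero =>
    have := P.qp
    fin_cases j
    · simp [opB_e_zero, opC_e_zero, opB_e_one, -opA_e]
    -- The genuine consistency check: B applied to C² B^k, using the Casimir formula for C².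
    · simp only [Fin.mk_one, Fin.isValue, LinearMap.sub_apply, Module.End.mul_apply,
        LinearMap.smul_apply, Module.End.one_apply, LinearMap.zero_apply, opC_e_one, opB_e_one,
        opB_e_zero, opC_e_zero, opB_opA, opC_opA, map_add, map_sub, map_smul]
      match_scalars <;> grind
  | succ i ih =>
    rw [← opA_e, ← Module.End.mul_apply, ← hT.eq, Module.End.mul_apply, ih]
    simp

theorem opA_pow_e (n i : ℕ) (j : Fin 2) (k : ℕ) : (opA ^ n) (e R i j k) = e R (i + n) j k := by
  induction n with
  | zero => simp
  | succ n ih => rw [pow_succ', Module.End.mul_apply, ih, opA_e, add_assoc]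

theorem opB_pow_e (n k : ℕ) : (P.opB ^ n) (e R 0 0 k) = e R 0 0 (k + n) := by
  induction n with
  | zero => simp
  | succ n ih => rw [pow_succ', Module.End.mul_apply, ih, opB_e_zero, add_assoc]

theorem opC_pow_e (j : Fin 2) (k : ℕ) : (P.opC ^ (j : ℕ)) (e R 0 0 k) = e R 0 j k := by
  fin_cases j <;> simp [opC_e_zero]

/-- The vector e_000 is cyclic, and each basis vector is its own monomial applied to it. -/
theorem monomial_op_e (i : ℕ) (j : Fin 2) (k : ℕ) :
    (opA ^ i * P.opC ^ (j : ℕ) * P.opB ^ k : Module.End R (Model R)) (e R 0 0 0) = e R i j k := by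
  simp only [Module.End.mul_apply, opB_pow_e, opC_pow_e, opA_pow_e, zero_add]

theorem casimir_op_e : P.casimir opA P.opB P.opC (e R 0 0 0) = P.w • e R 0 0 0 := by
  have := P.qp
  simp only [casimir, pow_two opA, pow_two P.opB, pow_two P.opC, LinearMap.sub_apply,
    LinearMap.add_apply, Module.End.mul_apply, LinearMap.smul_apply, opC_e_one, opB_e_zero,
    opC_e_zero]
  match_scalars <;> grind

/-- The Casimir operator commutes with A, B, C, so its value on the cyclic vector determines it. -/
theorem casimir_op : P.casimir opA P.opB P.opC = algebraMap R _ P.w := by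
  obtain ⟨hA, hB, hC⟩ := P.relations_op.commute_casimir
  refine hom_ext fun i j k => ?_
  have h : Commute (opA ^ i * P.opC ^ (j : ℕ) * P.opB ^ k) (P.casimir opA P.opB P.opC) :=
    ((hA.pow_left i).mul_left (hC.pow_left j)).mul_left (hB.pow_left k)
  rw [← P.monomial_op_e, ← Module.End.mul_apply, ← h.eq, Module.End.mul_apply, casimir_op_e,
    map_smul, Module.algebraMap_end_apply]

/-! ### Evaluating the model in an algebra -/

section

variable {D : Type*} [Ring D] [Algebra R D] {A B C : D}

/-- The linear map sending the basis vector `A^i C^j B^k` of the model to the monomial. -/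
noncomputable def eval (A B C : D) : Model R →ₗ[R] D :=
  ofBasis fun i j k => A ^ i * C ^ (j : ℕ) * B ^ k

@[simp] theorem eval_opA (v : Model R) : eval A B C (opA v) = A * eval A B C v := by
  have : eval A B C ∘ₗ opA = LinearMap.mulLeft R A ∘ₗ eval (R := R) A B C :=
    hom_ext fun i j k => by simp [eval, pow_succ', mul_assoc]
  exact congr($this v)

/-- The operators were read off from identities that hold in any such algebra once its Casimir
element is w. -/
theorem Relations.eval_op (h : P.Relations A B C)
    (hw : P.casimir A B C = algebraMap R D P.w) (v : Model R) :
    eval A B C (P.opB v) = B * eval A B C v ∧ eval A B C (P.opC v) = C * eval A B C v := by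
  suffices key : eval A B C ∘ₗ P.opB = LinearMap.mulLeft R B ∘ₗ eval (R := R) A B C ∧
      eval A B C ∘ₗ P.opC = LinearMap.mulLeft R C ∘ₗ eval (R := R) A B C from
    ⟨congr($(key.1) v), congr($(key.2) v)⟩
  suffices key : ∀ i j k, eval A B C (P.opB (e R i j k)) = B * eval A B C (e R i j k) ∧
      eval A B C (P.opC (e R i j k)) = C * eval A B C (e R i j k) from
    ⟨hom_ext fun i j k => (key i j k).1, hom_ext fun i j k => (key i j k).2⟩
  intro i j k
  have hqp := P.qp
  have e0 (k : ℕ) : eval A B C (e R 0 0 k) = B ^ k := by simp [eval]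
  have e1 (k : ℕ) : eval A B C (e R 0 1 k) = C * B ^ k := by simp [eval]
  induction i with
  | zero =>
    fin_cases j
    · simp [opB_e_zero, opC_e_zero, e0, e1, pow_succ', -opA_e]
    · constructor
      · simp only [Fin.mk_one, opB_e_one, map_add, map_sub, map_smul, eval_opA, e0, e1]
        rw [← mul_assoc, h.mul_BC]
        simp [add_mul, sub_mul, mul_assoc, pow_succ']
      · have hC : C * C = P.p ^ 2 • (P.w • 1 - P.p • (A * C * B) - P.p ^ 2 • (A * A)
            - P.p ^ 2 • (B * B) + (P.p * (P.q + P.p) * P.a) • A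
            + (P.p * (P.q + P.p) * P.b) • B + (P.q * (P.q + P.p) * P.g) • C) := by
          rw [← Algebra.algebraMap_eq_smul_one P.w, ← hw, casimir]
          simp only [pow_two A, pow_two B, pow_two C]
          match_scalars <;> grind
        simp only [Fin.mk_one, opC_e_one, map_add, map_sub, map_smul, eval_opA, e0, e1]
        rw [← mul_assoc C C, hC]
        simp [add_mul, sub_mul, mul_assoc, pow_succ']
  | succ i ih =>
    rw [← opA_e, opB_opA, opC_opA, eval_opA, ← mul_assoc, ← mul_assoc, h.mul_BA, h.mul_CA]
    simp [ih.1, ih.2, sub_mul, add_mul, mul_assoc, -Finsupp.smul_single]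

end

end Params

end UAW

/-! ### Central expressions over a field versus solved relations -/

namespace UAW

section

variable {F : Type*} [Field F] {q : F}

/-- The parameters over an `F`-algebra `K` attached to `q` and to four elements of `K`. -/
def Params.ofField {K : Type*} [CommRing K] [Algebra F K] (hq : q ≠ 0) (a b g w : K) :
    Params K where
  q := algebraMap F K q
  p := algebraMap F K q⁻¹
  a := a
  b := b
  g := g
  w := w
  qp := by rw [← map_mul, mul_inv_cancel₀ hq, map_one]

theorem sq_sub_inv_sq_ne_zero (hq : q ≠ 0) (hq4 : q ^ 4 ≠ 1) : q ^ 2 - q⁻¹ ^ 2 ≠ 0 := by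
  intro h
  apply hq4
  field_simp at h
  linear_combination h

theorem add_inv_ne_zero (hq : q ≠ 0) (hq4 : q ^ 4 ≠ 1) : q + q⁻¹ ≠ 0 := by
  intro h
  apply sq_sub_inv_sq_ne_zero hq hq4
  linear_combination (q - q⁻¹) * h

section

variable {D : Type*} [Ring D] [Algebra F D]

theorem centralExpr_eq_iff (hq : q ≠ 0) (hδ : q ^ 2 - q⁻¹ ^ 2 ≠ 0) {X Y Z c : D} :
    centralExpr q X Y Z = c ↔
      Y * Z = q⁻¹ ^ 2 • (Z * Y) + (q⁻¹ * (q ^ 2 - q⁻¹ ^ 2)) • (c - X) := by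
  generalize hd : q ^ 2 - q⁻¹ ^ 2 = d at hδ ⊢
  unfold centralExpr
  rw [hd]
  constructor
  · rintro rfl
    match_scalars <;> field_simp <;> ring
  · intro h
    rw [h]
    match_scalars <;> field_simp <;> ring

theorem centralExpr_eq_iff' (hq : q ≠ 0) (hδ : q ^ 2 - q⁻¹ ^ 2 ≠ 0) {X Y Z c : D} :
    centralExpr q X Y Z = c ↔
      Z * Y = q ^ 2 • (Y * Z) - (q * (q ^ 2 - q⁻¹ ^ 2)) • (c - X) := by
  generalize hd : q ^ 2 - q⁻¹ ^ 2 = d at hδ ⊢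
  unfold centralExpr
  rw [hd]
  constructor
  · rintro rfl
    match_scalars <;> field_simp <;> ring
  · intro h
    rw [h]
    match_scalars <;> field_simp <;> ring

variable {K : Type*} [CommRing K] [Algebra F K] [Algebra K D] [IsScalarTower F K D]

theorem relations_ofField_iff (hq : q ≠ 0) (hδ : q ^ 2 - q⁻¹ ^ 2 ≠ 0) {A B C : D}
    {a b g w : K} :
    (Params.ofField hq a b g w).Relations A B C ↔
      centralExpr q A B C = algebraMap K D a ∧ centralExpr q B C A = algebraMap K D b ∧
        centralExpr q C A B = algebraMap K D g := by
  rw [centralExpr_eq_iff hq hδ, centralExpr_eq_iff hq hδ, centralExpr_eq_iff' hq hδ]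
  simp only [Algebra.algebraMap_eq_smul_one]
  have key (x : F) (y : D) : algebraMap F K x • y = x • y := algebraMap_smul K x y
  constructor
  · rintro ⟨h1, h2, h3⟩
    simp only [Params.ofField, Params.δ, ← map_pow, ← map_mul, ← map_sub, key] at h1 h2 h3
    exact ⟨h3, h2, h1⟩
  · rintro ⟨h1, h2, h3⟩
    constructor <;>
    · simp only [Params.ofField, Params.δ, ← map_pow, ← map_mul, ← map_sub, key]
      assumption

theorem casimir_ofField (hq : q ≠ 0) {A B C : D} {a b g w : K}
    (ha : centralExpr q A B C = algebraMap K D a) (hb : centralExpr q B C A = algebraMap K D b)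
    (hg : centralExpr q C A B = algebraMap K D g) :
    (Params.ofField hq a b g w).casimir A B C =
      q⁻¹ • (A * C * B) + q⁻¹ ^ 2 • A ^ 2 + q⁻¹ ^ 2 • B ^ 2 + q ^ 2 • C ^ 2
        - q⁻¹ • (A * (q + q⁻¹) • centralExpr q A B C)
        - q⁻¹ • (B * (q + q⁻¹) • centralExpr q B C A)
        - q • (C * (q + q⁻¹) • centralExpr q C A B) := by
  have key (x : F) (y : D) : algebraMap F K x • y = x • y := algebraMap_smul K x y
  have hmul (X : D) (s : F) (c : K) : X * s • algebraMap K D c = s • c • X := by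
    rw [mul_smul_comm, ← Algebra.commutes, ← Algebra.smul_def]
  rw [ha, hb, hg]
  simp only [Params.ofField, Params.casimir, ← map_pow, ← map_add, mul_smul, key, hmul]

end

end

end UAW

/-! ### Central elements and representations of Δ_q -/

namespace UniversalAskeyWilson

open UAW

variable {F : Type*} [Field F] {q : F}

theorem induction_gen {motive : UniversalAskeyWilson q → Prop}
    (algebraMap : ∀ r : F, motive (algebraMap F _ r)) (A : motive (A q)) (B : motive (B q))
    (C : motive (C q)) (mul : ∀ x y, motive x → motive y → motive (x * y))
    (add : ∀ x y, motive x → motive y → motive (x + y)) (x : UniversalAskeyWilson q) :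
    motive x := by
  obtain ⟨y, rfl⟩ := RingQuot.mkAlgHom_surjective F (Rel q) x
  induction y using FreeAlgebra.induction with
  | grade0 r => simpa using algebraMap r
  | grade1 g => cases g <;> assumption
  | mul x y hx hy => simpa using mul _ _ hx hy
  | add x y hx hy => simpa using add _ _ hx hy

theorem mem_center_of_commute {z : UniversalAskeyWilson q} (hA : Commute (A q) z)
    (hB : Commute (B q) z) (hC : Commute (C q) z) :
    z ∈ Subalgebra.center F (UniversalAskeyWilson q) := by
  rw [Subalgebra.mem_center_iff]
  intro x
  change Commute x z
  induction x using induction_gen with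
  | algebraMap r => exact Algebra.commute_algebraMap_left r z
  | A => exact hA
  | B => exact hB
  | C => exact hC
  | mul x y hx hy => exact hx.mul_left hy
  | add x y hx hy => exact hx.add_left hy

theorem mkAlgHom_centralExpr (x y z : AWGen) :
    RingQuot.mkAlgHom F (Rel q) (centralExpr q (FreeAlgebra.ι F x) (FreeAlgebra.ι F y)
      (FreeAlgebra.ι F z)) = centralExpr q (gen q x) (gen q y) (gen q z) := by
  simp [centralExpr, gen]

theorem centralExpr_mem_center {x y z : AWGen}
    (h : ∀ w, Rel q (centralExpr q (FreeAlgebra.ι F x) (FreeAlgebra.ι F y)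
        (FreeAlgebra.ι F z) * w) (w * centralExpr q (FreeAlgebra.ι F x) (FreeAlgebra.ι F y)
        (FreeAlgebra.ι F z))) :
    centralExpr q (gen q x) (gen q y) (gen q z) ∈
      Subalgebra.center F (UniversalAskeyWilson q) := by
  rw [Subalgebra.mem_center_iff, ← mkAlgHom_centralExpr]
  intro u
  obtain ⟨u, rfl⟩ := RingQuot.mkAlgHom_surjective F (Rel q) u
  rw [← map_mul, ← map_mul]
  exact (RingQuot.mkAlgHom_rel F (h u)).symm

theorem centralExpr_ABC_mem_center :
    centralExpr q (A q) (B q) (C q) ∈ Subalgebra.center F (UniversalAskeyWilson q) :=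
  centralExpr_mem_center Rel.centralA

theorem centralExpr_BCA_mem_center :
    centralExpr q (B q) (C q) (A q) ∈ Subalgebra.center F (UniversalAskeyWilson q) :=
  centralExpr_mem_center Rel.centralB

theorem centralExpr_CAB_mem_center :
    centralExpr q (C q) (A q) (B q) ∈ Subalgebra.center F (UniversalAskeyWilson q) :=
  centralExpr_mem_center Rel.centralC

theorem α_mem_center : α q ∈ Subalgebra.center F (UniversalAskeyWilson q) :=
  Subalgebra.smul_mem _ centralExpr_ABC_mem_center _

theorem β_mem_center : β q ∈ Subalgebra.center F (UniversalAskeyWilson q) :=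
  Subalgebra.smul_mem _ centralExpr_BCA_mem_center _

theorem γ_mem_center : γ q ∈ Subalgebra.center F (UniversalAskeyWilson q) :=
  Subalgebra.smul_mem _ centralExpr_CAB_mem_center _

/-- Over its own center, Δ_q has scalar central expressions, so the parametric computation applies.
-/
theorem Ω_mem_center (hq : q ≠ 0) (hq4 : q ^ 4 ≠ 1) :
    Ω q ∈ Subalgebra.center F (UniversalAskeyWilson q) := by
  let Z := Subalgebra.center F (UniversalAskeyWilson q)
  let : Algebra Z (UniversalAskeyWilson q) :=
    Z.val.toRingHom.toAlgebra' fun c x => (Subalgebra.mem_center_iff.1 c.2 x).symm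
  have : @IsScalarTower F Z (UniversalAskeyWilson q) _ Algebra.toSMul _ :=
    IsScalarTower.of_algebraMap_eq fun x => rfl
  let a : Z := ⟨_, centralExpr_ABC_mem_center⟩
  let b : Z := ⟨_, centralExpr_BCA_mem_center⟩
  let g : Z := ⟨_, centralExpr_CAB_mem_center⟩
  have h : (Params.ofField hq a b g 0).Relations (A q) (B q) (C q) :=
    (relations_ofField_iff hq (sq_sub_inv_sq_ne_zero hq hq4)).2 ⟨rfl, rfl, rfl⟩
  have hΩ : (Params.ofField hq a b g 0).casimir (A q) (B q) (C q) = Ω q :=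
    casimir_ofField hq rfl rfl rfl
  obtain ⟨hA, hB, hC⟩ := h.commute_casimir
  rw [hΩ] at hA hB hC
  exact mem_center_of_commute hA hB hC

/-- The representation of `Δ_q` given by operators that satisfy the relations. -/
noncomputable def rep {K E : Type*} [CommRing K] [Algebra F K] [Ring E] [Algebra F E] [Algebra K E]
    [IsScalarTower F K E] (hq : q ≠ 0) (hq4 : q ^ 4 ≠ 1) {a b g w : K} {A B C : E}
    (h : (Params.ofField hq a b g w).Relations A B C) : UniversalAskeyWilson q →ₐ[F] E :=
  RingQuot.liftAlgHom F
    ⟨FreeAlgebra.lift F fun | .A => A | .B => B | .C => C, by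
      obtain ⟨ha, hb, hg⟩ := (relations_ofField_iff hq (sq_sub_inv_sq_ne_zero hq hq4)).1 h
      unfold centralExpr at ha hb hg
      rintro _ _ (x | x | x) <;>
      simp only [centralExpr, map_mul, map_add, map_smul, map_sub, FreeAlgebra.lift_ι_apply, ha,
        hb, hg, Algebra.commutes]⟩

section

variable {K E : Type*} [CommRing K] [Algebra F K] [Ring E] [Algebra F E] [Algebra K E]
  [IsScalarTower F K E] (hq : q ≠ 0) (hq4 : q ^ 4 ≠ 1) {a b g w : K} {A' B' C' : E}
  (h : (Params.ofField hq a b g w).Relations A' B' C')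

@[simp] theorem rep_A : rep hq hq4 h (A q) = A' := by simp [rep, A, gen]

@[simp] theorem rep_B : rep hq hq4 h (B q) = B' := by simp [rep, B, gen]

@[simp] theorem rep_C : rep hq hq4 h (C q) = C' := by simp [rep, C, gen]

theorem rep_centralExpr (x y z : UniversalAskeyWilson q) :
    rep hq hq4 h (centralExpr q x y z) =
      centralExpr q (rep hq hq4 h x) (rep hq hq4 h y) (rep hq hq4 h z) := by
  simp [centralExpr]

theorem rep_α : rep hq hq4 h (α q) = algebraMap K E (algebraMap F K (q + q⁻¹) * a) := by
  have := (relations_ofField_iff hq (sq_sub_inv_sq_ne_zero hq hq4)).1 h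
  rw [α, map_smul, rep_centralExpr, rep_A, rep_B, rep_C, this.1, map_mul,
    ← IsScalarTower.algebraMap_apply, Algebra.smul_def]

theorem rep_β : rep hq hq4 h (β q) = algebraMap K E (algebraMap F K (q + q⁻¹) * b) := by
  have := (relations_ofField_iff hq (sq_sub_inv_sq_ne_zero hq hq4)).1 h
  rw [β, map_smul, rep_centralExpr, rep_A, rep_B, rep_C, this.2.1, map_mul,
    ← IsScalarTower.algebraMap_apply, Algebra.smul_def]

theorem rep_γ : rep hq hq4 h (γ q) = algebraMap K E (algebraMap F K (q + q⁻¹) * g) := by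
  have := (relations_ofField_iff hq (sq_sub_inv_sq_ne_zero hq hq4)).1 h
  rw [γ, map_smul, rep_centralExpr, rep_A, rep_B, rep_C, this.2.2, map_mul,
    ← IsScalarTower.algebraMap_apply, Algebra.smul_def]

theorem rep_Ω : rep hq hq4 h (Ω q) = (Params.ofField hq a b g w).casimir A' B' C' := by
  have := (relations_ofField_iff hq (sq_sub_inv_sq_ne_zero hq hq4)).1 h
  rw [casimir_ofField hq this.1 this.2.1 this.2.2]
  simp [Ω, α, β, γ, rep_centralExpr]

end

/-! ### Freeness over the polynomial ring -/

/-- The polynomial ring in `Ω, α, β, γ`. -/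
abbrev CasimirRing (F : Type*) [Field F] : Type _ := MvPolynomial (Fin 4) F

/-- The universal parameters: the variables stand for `Ω, α, β, γ`. -/
noncomputable def params (hq : q ≠ 0) : Params (CasimirRing F) :=
  -- The parameters are values of the central expressions, while α, β, γ carry the factor q + q⁻¹.
  Params.ofField hq ((q + q⁻¹)⁻¹ • MvPolynomial.X 1) ((q + q⁻¹)⁻¹ • MvPolynomial.X 2)
    ((q + q⁻¹)⁻¹ • MvPolynomial.X 3) (MvPolynomial.X 0)

section

variable [Algebra (CasimirRing F) (UniversalAskeyWilson q)]
  [IsScalarTower F (CasimirRing F) (UniversalAskeyWilson q)]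

/-- The representation is only F-linear by construction; this makes it linear over the polynomial
ring. -/
theorem rep_algebraMap (hq : q ≠ 0) (hq4 : q ^ 4 ≠ 1)
    (h0 : algebraMap (CasimirRing F) (UniversalAskeyWilson q) (.X 0) = Ω q)
    (h1 : algebraMap (CasimirRing F) (UniversalAskeyWilson q) (.X 1) = α q)
    (h2 : algebraMap (CasimirRing F) (UniversalAskeyWilson q) (.X 2) = β q)
    (h3 : algebraMap (CasimirRing F) (UniversalAskeyWilson q) (.X 3) = γ q)
    (r : CasimirRing F) :
    rep hq hq4 (params hq).relations_op (algebraMap _ _ r) = algebraMap _ _ r := by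
  suffices key : (rep hq hq4 (params hq).relations_op).comp
      (IsScalarTower.toAlgHom F (CasimirRing F) (UniversalAskeyWilson q)) =
      IsScalarTower.toAlgHom F (CasimirRing F) _ from congr($key r)
  have hs := add_inv_ne_zero hq hq4
  have hX (i : Fin 4) : algebraMap F (CasimirRing F) (q + q⁻¹) *
      ((q + q⁻¹)⁻¹ • MvPolynomial.X i) = MvPolynomial.X i := by
    rw [← Algebra.smul_def, smul_inv_smul₀ hs]
  refine MvPolynomial.algHom_ext fun i => ?_
  simp only [AlgHom.comp_apply, IsScalarTower.coe_toAlgHom']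
  fin_cases i
  · exact (congrArg _ h0).trans ((rep_Ω ..).trans (params hq).casimir_op)
  · exact (congrArg _ h1).trans ((rep_α ..).trans (congrArg _ (hX 1)))
  · exact (congrArg _ h2).trans ((rep_β ..).trans (congrArg _ (hX 2)))
  · exact (congrArg _ h3).trans ((rep_γ ..).trans (congrArg _ (hX 3)))

theorem relations_params (hq : q ≠ 0) (hq4 : q ^ 4 ≠ 1)
    (h0 : algebraMap (CasimirRing F) (UniversalAskeyWilson q) (.X 0) = Ω q)
    (h1 : algebraMap (CasimirRing F) (UniversalAskeyWilson q) (.X 1) = α q)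
    (h2 : algebraMap (CasimirRing F) (UniversalAskeyWilson q) (.X 2) = β q)
    (h3 : algebraMap (CasimirRing F) (UniversalAskeyWilson q) (.X 3) = γ q) :
    (params hq).Relations (A q) (B q) (C q) ∧
      (params hq).casimir (A q) (B q) (C q) = algebraMap _ _ (params hq).w := by
  have hs := add_inv_ne_zero hq hq4
  have hc (x : CasimirRing F) (c : UniversalAskeyWilson q)
      (hx : algebraMap _ _ x = (q + q⁻¹) • c) :
      c = algebraMap _ _ ((q + q⁻¹)⁻¹ • x) := by
    have := map_smul (IsScalarTower.toAlgHom F (CasimirRing F) (UniversalAskeyWilson q))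
      (q + q⁻¹)⁻¹ x
    simp only [IsScalarTower.coe_toAlgHom'] at this
    rw [this, hx, inv_smul_smul₀ hs]
  have ha := hc _ _ h1
  have hb := hc _ _ h2
  have hg := hc _ _ h3
  exact ⟨(relations_ofField_iff hq (sq_sub_inv_sq_ne_zero hq hq4)).2 ⟨ha, hb, hg⟩,
    (casimir_ofField hq ha hb hg).trans h0.symm⟩

/-- `Δ_q` is the model, as a module over the polynomials in `Ω, α, β, γ`. -/
theorem exists_linearEquiv_model (hq : q ≠ 0) (hq4 : q ^ 4 ≠ 1)
    (h0 : algebraMap (CasimirRing F) (UniversalAskeyWilson q) (.X 0) = Ω q)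
    (h1 : algebraMap (CasimirRing F) (UniversalAskeyWilson q) (.X 1) = α q)
    (h2 : algebraMap (CasimirRing F) (UniversalAskeyWilson q) (.X 2) = β q)
    (h3 : algebraMap (CasimirRing F) (UniversalAskeyWilson q) (.X 3) = γ q) :
    ∃ f : Params.Model (CasimirRing F) ≃ₗ[CasimirRing F] UniversalAskeyWilson q,
      ∀ i j k, f (Params.e _ i j k) = A q ^ i * C q ^ (j : ℕ) * B q ^ k := by
  obtain ⟨hrel, hcas⟩ := relations_params hq hq4 h0 h1 h2 h3
  let ρ := rep hq hq4 (params hq).relations_op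
  have hA : ρ (A q) = Params.opA := rep_A ..
  have hB : ρ (B q) = (params hq).opB := rep_B ..
  have hC : ρ (C q) = (params hq).opC := rep_C ..
  have hρ : ∀ r, ρ (algebraMap _ _ r) = algebraMap _ _ r := rep_algebraMap hq hq4 h0 h1 h2 h3
  let φ : Params.Model (CasimirRing F) →ₗ[CasimirRing F] UniversalAskeyWilson q :=
    Params.eval (A q) (B q) (C q)
  have hφ (i j k) : φ (Params.e _ i j k) = A q ^ i * C q ^ (j : ℕ) * B q ^ k :=
    Params.ofBasis_e ..
  let ψ : UniversalAskeyWilson q →ₗ[CasimirRing F] Params.Model (CasimirRing F) :=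
    { toFun := fun x => ρ x (Params.e _ 0 0 0)
      map_add' := fun x y => by simp
      map_smul' := fun r x => by
        rw [Algebra.smul_def, map_mul, hρ, Module.End.mul_apply, Module.algebraMap_end_apply,
          RingHom.id_apply] }
  have hmul (x : UniversalAskeyWilson q) : ∀ v, φ (ρ x v) = x * φ v := by
    induction x using induction_gen with
    | algebraMap r =>
      intro v
      rw [IsScalarTower.algebraMap_apply F (CasimirRing F), hρ, Module.algebraMap_end_apply,
        map_smul, Algebra.smul_def]
    | A => intro v; rw [hA]; exact Params.eval_opA v
    | B => intro v; rw [hB]; exact (hrel.eval_op _ hcas v).1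
    | C => intro v; rw [hC]; exact (hrel.eval_op _ hcas v).2
    | mul x y hx hy => intro v; rw [map_mul, Module.End.mul_apply, hx, hy, mul_assoc]
    | add x y hx hy => intro v; rw [map_add, LinearMap.add_apply, map_add, hx, hy, add_mul]
  -- φψ = id since φ intertwines the actions and sends e_000 to 1; ψφ = id by cyclicity of e_000.
  refine ⟨LinearEquiv.ofLinearMap φ ψ (LinearMap.ext fun x => ?_)
    (Params.hom_ext fun i j k => ?_), hφ⟩
  · exact (hmul x _).trans (by simp [hφ])
  · change ρ (φ (Params.e _ i j k)) (Params.e _ 0 0 0) = _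
    rw [hφ, map_mul, map_mul, map_pow, map_pow, map_pow, hA, hB, hC]
    exact (params hq).monomial_op_e i j k

end

/-! ### The basis over F -/

/-- Exponent vectors of monomials `A^i C^j B^k Ω^l α^r β^s γ^t`, with the central part split off. -/
noncomputable def exponentEquiv :
    (Fin 4 →₀ ℕ) × (ℕ × Fin 2 × ℕ) ≃ ℕ × Fin 2 × ℕ × ℕ × ℕ × ℕ × ℕ where
  toFun x := (x.2.1, x.2.2.1, x.2.2.2, x.1 0, x.1 1, x.1 2, x.1 3)
  invFun y := (Finsupp.equivFunOnFinite.symm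
    ![y.2.2.2.1, y.2.2.2.2.1, y.2.2.2.2.2.1, y.2.2.2.2.2.2], y.1, y.2.1, y.2.2.1)
  left_inv x := by
    refine Prod.ext (Finsupp.ext fun i => ?_) rfl
    fin_cases i <;> rfl
  right_inv y := rfl

end UniversalAskeyWilson

theorem theorem2 {F : Type*} [Field F] (q : F) (hq : q ≠ 0) (hq4 : q ^ 4 ≠ 1) :
    ∃ b : Module.Basis (ℕ × Fin 2 × ℕ × ℕ × ℕ × ℕ × ℕ) F (UniversalAskeyWilson q),
      ∀ (i : ℕ) (j : Fin 2) (k l r s t : ℕ),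
        b (i, j, k, l, r, s, t) =
          UniversalAskeyWilson.A q ^ i * UniversalAskeyWilson.C q ^ (j : ℕ) *
            UniversalAskeyWilson.B q ^ k * UniversalAskeyWilson.Ω q ^ l *
            UniversalAskeyWilson.α q ^ r * UniversalAskeyWilson.β q ^ s *
            UniversalAskeyWilson.γ q ^ t := by
  open UniversalAskeyWilson in
  let Z := Subalgebra.center F (UniversalAskeyWilson q)
  let z : Fin 4 → Z := ![⟨_, Ω_mem_center hq hq4⟩, ⟨_, α_mem_center⟩, ⟨_, β_mem_center⟩,
    ⟨_, γ_mem_center⟩]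
  let σ : CasimirRing F →ₐ[F] UniversalAskeyWilson q := Z.val.comp (MvPolynomial.aeval z)
  let : Algebra (CasimirRing F) (UniversalAskeyWilson q) :=
    σ.toRingHom.toAlgebra' fun c x =>
      (Subalgebra.mem_center_iff.1 (MvPolynomial.aeval z c).2 x).symm
  have : IsScalarTower F (CasimirRing F) (UniversalAskeyWilson q) :=
    IsScalarTower.of_algebraMap_eq fun x => (σ.commutes x).symm
  have hX (i : Fin 4) : algebraMap (CasimirRing F) (UniversalAskeyWilson q) (.X i) = z i :=
    congrArg Z.val (MvPolynomial.aeval_X z i)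
  obtain ⟨f, hf⟩ := exists_linearEquiv_model hq hq4 (hX 0) (hX 1) (hX 2) (hX 3)
  -- Multiply the F-basis of polynomial monomials by the basis over the polynomial ring.
  refine ⟨((MvPolynomial.basisMonomials (Fin 4) F).smulTower
    (Finsupp.basisSingleOne.map f)).reindex exponentEquiv, fun i j k l r s t => ?_⟩
  rw [Module.Basis.reindex_apply, Module.Basis.smulTower_apply]
  simp only [exponentEquiv, Module.Basis.map_apply,
    Finsupp.coe_basisSingleOne, MvPolynomial.coe_basisMonomials, hf]
  rw [Algebra.smul_def, Algebra.commutes, MvPolynomial.monomial_eq,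
    Finsupp.prod_fintype _ _ (by simp), Fin.prod_univ_four]
  simp only [map_one, one_mul, map_mul, map_pow, hX, ← mul_assoc]
  rfl
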